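/- Let $\mathcal{E}$ be a finite-dimensional real inner product space and let $\lambda:\mathcal{E}\to\mathbb{R}^r$ be such that $(\mathcal{E},\mathbb{R}^r,\lambda)$ is a Fan–Theobald–von Neumann system, i.e. $\|\lambda(x)\|_2=\|x\|$ and $\langle x,y\rangle\le\langle\lambda(x),\lambda(y)\rangle$ for all $x,y\in\mathcal{E}$, and for all $c\in\mathcal{E}$ and $\mu\in\lambda(\mathcal{E})$ there is $z\in\mathcal{E}$ with $\lambda(z)=\mu$ and $\langle c,z\rangle=\langle\lambda(c),\lambda(z)\rangle$. Let $\mathcal{C}\subseteq\mathbb{R}^r$, let $\bar{\mathcal{C}}\subseteq\mathcal{E}$ be convex, and let $\bar x\in\mathcal{E}$. For $S\subseteq\mathcal{E}$ let $\delta_S$ be its indicator function ($0$ on $S$, $+\infty$ off $S$) and $\operatorname{proj}_S(x)=\{z\in S: \|z-x\|=\operatorname{dist}(x,S)\}$. Let $\hat\partial F$ and $\partial F$ be the regular and the limiting subdifferential of $F:\mathcal{E}\to\mathbb{R}\cup\{+\infty\}$: for $F(x)<+\infty$, $d\in\hat\partial F(x)$ iff $\liminf_{v\to0,\,v\ne0}\frac{F(x+v)-F(x)-\langle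 d,v\rangle}{\|v\|}\ge0$, and $d\in\partial F(x)$ iff there are $x^k\to x$ and $d^k\to d$ with $F(x^k)\to F(x)$ and $d^k\in\hat\partial F(x^k)$ for all $k$; both sets are empty where $F(x)=+\infty$. A point $x$ is critical for $F$ if $0\in\partial F(x)$; $N_S(x)=\partial\delta_S(x)$ is the limiting normal cone. $F$ has the KL property with exponent $\frac12$ at $\bar x$ if $\partial F(\bar x)\neq\emptyset$ and there are $c,\epsilon>0$ and $\nu\in(0,\infty]$ such that $\operatorname{dist}(0,\partial F(x))\ge c\,(F(x)-F(\bar x))^{1/2}$ whenever $\|x-\bar x\|\le\epsilon$ and $F(\bar x)<F(x)<F(\bar x)+\nu$ (with $\operatorname{dist}(0,\emptyset)=+\infty$). Let $F=\frac12\operatorname{dist}(\cdot,\bar{\mathcal{C}})^2+\delta_{\lambda^{-1}(\mathcal{C})}$, and consider sequences $(x_k)_{k\ge0}$ in $\mathcal{E}$ satisfying, for all $k\ge 0$, $$y_k=(1-\alpha_k)x_k+\alpha_k\operatorname{proj}_{\bar{\mathcal{C}}}(x_k),\qquad x_{k+1}\in\operatorname{proj}_{\lambda^{-1}(\mathcal{C})}(y_k)$$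 (in particular, the projection of each $x_k$ onto $\bar{\mathcal{C}}$ exists), where for some $\varepsilon\in(0,\frac12)$ the step sizes satisfy $\alpha_k\in(\varepsilon,1-\varepsilon)$ for all $k$. 1. If such a sequence converges to $\bar x$, $\bar x$ is a critical point of $F$, and $F$ has the KL property with exponent $\frac12$ at $\bar x$, then the convergence is linear: there are $M>0$ and $q\in(0,1)$ with $\|x_k-\bar x\|\le Mq^k$ for all $k$. 2. In particular, suppose that $\bar x\in\bar{\mathcal{C}}\cap\lambda^{-1}(\mathcal{C})$ and that $\bar{\mathcal{C}}$ and $\lambda^{-1}(\mathcal{C})$ are transversal at $\bar x$, i.e. $N_{\bar{\mathcal{C}}}(\bar x)\cap\bigl(-N_{\lambda^{-1}(\mathcal{C})}(\bar x)\bigr)=\{0\}$. Then $\bar x$ is a critical point of $F$, $F$ has the KL property with exponent $\frac12$ at $\bar x$, and every such sequence that converges to $\bar x$ converges linearly. -/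

import Mathlib

open Filter Topology

noncomputable section

namespace EigProg

variable {E : Type*} [NormedAddCommGroup E] [InnerProductSpace ℝ E]

/-! ### Fan-Theobald-von Neumann systems -/

/-- The set `U(c, μ) = {z | lam z = μ and ⟪c, z⟫ = ⟪lam c, lam z⟫}`. -/
def commutingSet {r : ℕ} (lam : E → EuclideanSpace ℝ (Fin r)) (c : E)
    (μ : EuclideanSpace ℝ (Fin r)) : Set E :=
  {z | lam z = μ ∧ inner ℝ c z = inner ℝ (lam c) (lam z)}

/-- `(E, ℝ^r, lam)` is a Fan-Theobald-von Neumann (FTvN) system. -/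
structure IsFTvN {r : ℕ} (lam : E → EuclideanSpace ℝ (Fin r)) : Prop where
  norm_map : ∀ x : E, ‖lam x‖ = ‖x‖
  inner_le : ∀ x y : E, inner ℝ x y ≤ inner ℝ (lam x) (lam y)
  commuting_nonempty : ∀ c : E, ∀ μ ∈ Set.range lam, (commutingSet lam c μ).Nonempty

/-! ### Subdifferentials and normal cones

Functions with values in `ℝ ∪ {+∞}` are represented as `EReal`-valued functions. As usual, the
subdifferentials are empty at the points where the function is not finite. -/

/-- The regular (Fréchet) subdifferential of `F` at `x`. -/
def regularSubdiff (F : E → EReal) (x : E) : Set E :=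
  {d | F x ≠ ⊤ ∧ F x ≠ ⊥ ∧
    0 ≤ liminf (fun v : E => (F (x + v) - F x - ((inner ℝ d v : ℝ) : EReal)) / ((‖v‖ : ℝ) : EReal))
      (𝓝[≠] (0 : E))}

/-- The limiting (approximate, Mordukhovich) subdifferential of `F` at `x`. -/
def limitingSubdiff (F : E → EReal) (x : E) : Set E :=
  {d | F x ≠ ⊤ ∧ F x ≠ ⊥ ∧
    ∃ (xs ds : ℕ → E), (∀ k, ds k ∈ regularSubdiff F (xs k)) ∧
      Tendsto xs atTop (𝓝 x) ∧ Tendsto (fun k => F (xs k)) atTop (𝓝 (F x)) ∧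
      Tendsto ds atTop (𝓝 d)}

/-- `x` is a critical point of `F`. -/
def IsCriticalPoint (F : E → EReal) (x : E) : Prop :=
  (0 : E) ∈ limitingSubdiff F x

open Classical in
/-- The indicator function `δ_S`: `0` on `S` and `+∞` off `S`. -/
def indicatorFn (S : Set E) (x : E) : EReal :=
  if x ∈ S then 0 else ⊤

/-- The limiting normal cone of `S` at `x`. -/
def normalCone (S : Set E) (x : E) : Set E :=
  limitingSubdiff (indicatorFn S) x

/-- `S₁` and `S₂` are transversal at `x`: `N_{S₁}(x) ∩ (-N_{S₂}(x)) = {0}`. -/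
def Transversal (S₁ S₂ : Set E) (x : E) : Prop :=
  {d | d ∈ normalCone S₁ x ∧ -d ∈ normalCone S₂ x} = {0}

/-- `F` has the Kurdyka-Łojasiewicz property with exponent `α` at `xbar`. The distance to the
limiting subdifferential is taken in `[0, ∞]`, so that it is `∞` if the latter is empty. -/
def HasKLProperty (F : E → EReal) (xbar : E) (α : ℝ) : Prop :=
  (limitingSubdiff F xbar).Nonempty ∧
    ∃ (c ε : ℝ) (ν : EReal), 0 < c ∧ 0 < ε ∧ 0 < ν ∧
      ∀ x : E, ‖x - xbar‖ ≤ ε → F xbar < F x → F x < F xbar + ν →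
        ENNReal.ofReal (c * (F x - F xbar).toReal ^ α) ≤ Metric.infEDist 0 (limitingSubdiff F x)

/-! ### The feasibility problem and the iteration -/

/-- The set of projections of `x` onto `S`. -/
def projSet (S : Set E) (x : E) : Set E :=
  {z | z ∈ S ∧ ‖z - x‖ = Metric.infDist x S}

/-- The function `½ dist(·, Cbar)² + δ_S`. -/
def feasFn (Cbar S : Set E) (x : E) : EReal :=
  ((1 / 2 * Metric.infDist x Cbar ^ 2 : ℝ) : EReal) + indicatorFn S x

/-- The relaxed alternating projections `y_k = (1 - α_k) x_k + α_k proj_Cbar(x_k)`,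
`x_{k+1} ∈ proj_S(y_k)`. -/
def IsRelaxedAltProj (Cbar S : Set E) (α : ℕ → ℝ) (x : ℕ → E) : Prop :=
  ∀ k, ∃ p ∈ projSet Cbar (x k), x (k + 1) ∈ projSet S ((1 - α k) • x k + α k • p)

/-- The step sizes stay in `(ε, 1 - ε)` for some `ε ∈ (0, 1/2)`. -/
def AdmissibleSteps (α : ℕ → ℝ) : Prop :=
  ∃ ε : ℝ, 0 < ε ∧ ε < 1 / 2 ∧ ∀ k, ε < α k ∧ α k < 1 - ε

/-- The sequence `x` converges to `xbar` at a linear (geometric) rate. -/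
def ConvergesLinearly (x : ℕ → E) (xbar : E) : Prop :=
  ∃ M q : ℝ, 0 < M ∧ 0 < q ∧ q < 1 ∧ ∀ k, ‖x k - xbar‖ ≤ M * q ^ k

end EigProg

end

namespace EigProg

variable {E : Type*} [NormedAddCommGroup E] [InnerProductSpace ℝ E]

/-! ### Subdifferentials of a real function plus an indicator -/

/-! Write `S` for the preimage of `C`, `K` for the convex set, `P` for the projection onto the
closure of `K` and `g` for half the squared distance to `K`. Since `g` is convex with 1-Lipschitz
gradient `x - P x`, the iteration is projected gradient descent on `g` over `S` with steps below 1.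
Hence each step `s` lowers `g` by a multiple of `‖s‖²` (`half_infDist_sq_descent`), and some
subgradient at the new point has norm `O(‖s‖)` (`exists_mem_limitingSubdiff_feasFn_norm_le`).
Exponent 1/2 turns the latter into a gap `O(‖s‖²)` to the limit value; with the decrease, gap and
steps decay geometrically.

Under transversality, gradients of `g` and normals to `S` cannot nearly cancel close to `xbar`
(`exists_mul_norm_le_of_transversal_regular`), so subgradients are bounded below by a multiple of
`dist(x, K)`, which is the KL inequality. -/

theorem coe_add_indicatorFn_of_mem (G : E → ℝ) {S : Set E} {x : E} (hx : x ∈ S) :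
    ((G x : ℝ) : EReal) + indicatorFn S x = (G x : ℝ) := by
  simp [indicatorFn, hx]

theorem coe_add_indicatorFn_of_notMem (G : E → ℝ) {S : Set E} {x : E} (hx : x ∉ S) :
    ((G x : ℝ) : EReal) + indicatorFn S x = ⊤ := by
  simp [indicatorFn, hx]

/-- Off `S` the difference quotient is `+∞`, so only directions staying in `S` constrain the liminf.
-/
theorem mem_regularSubdiff_coe_add_indicatorFn {G : E → ℝ} {S : Set E} {x d : E} :
    d ∈ regularSubdiff (fun y => ((G y : ℝ) : EReal) + indicatorFn S y) x ↔
      x ∈ S ∧ ∀ ε : ℝ, 0 < ε → ∀ᶠ v in 𝓝[≠] (0 : E), x + v ∈ S →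
        -(ε * ‖v‖) ≤ G (x + v) - G x - inner ℝ d v := by
  by_cases hx : x ∈ S
  swap
  · simp [regularSubdiff, coe_add_indicatorFn_of_notMem G hx, hx]
  have key : ∀ (v : E) (a : ℝ), v ≠ 0 →
      (((a : ℝ) : EReal) < (((G (x + v) : ℝ) : EReal) + indicatorFn S (x + v) - (G x : ℝ) -
        ((inner ℝ d v : ℝ) : EReal)) / ((‖v‖ : ℝ) : EReal) ↔
        (x + v ∈ S → a * ‖v‖ < G (x + v) - G x - inner ℝ d v)) := by
    intro v a hv
    have hv' : 0 < ‖v‖ := norm_pos_iff.2 hv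
    by_cases hm : x + v ∈ S
    · rw [coe_add_indicatorFn_of_mem G hm, ← EReal.coe_sub, ← EReal.coe_sub, ← EReal.coe_div,
        EReal.coe_lt_coe_iff, lt_div_iff₀ hv']
      simp [hm]
    · rw [coe_add_indicatorFn_of_notMem G hm, EReal.top_sub_coe, EReal.top_sub_coe,
        EReal.top_div_of_pos_ne_top (by exact_mod_cast hv') (EReal.coe_ne_top _)]
      simp [hm]
  simp only [regularSubdiff, Set.mem_ofPred_eq, coe_add_indicatorFn_of_mem G hx, hx, true_and, ne_eq,
    EReal.coe_ne_top, EReal.coe_ne_bot, not_false_eq_true]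
  rw [le_liminf_iff (by isBoundedDefault) (by isBoundedDefault)]
  constructor
  · intro h ε hε
    filter_upwards [h ((-ε : ℝ) : EReal) (by exact_mod_cast neg_lt_zero.2 hε), self_mem_nhdsWithin]
      with v hv hv0 hm
    have := (key v (-ε) hv0).1 hv hm
    linarith
  · intro h a ha
    obtain ⟨b, hab, hb⟩ := EReal.lt_iff_exists_real_btwn.1 ha
    have hb' : b < 0 := by exact_mod_cast hb
    -- Half of `-b` leaves room for the strict inequality in `key`.
    filter_upwards [h (-b / 2) (by linarith), self_mem_nhdsWithin] with v hv hv0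
    refine hab.trans ((key v b hv0).2 fun hm => ?_)
    have hv' : 0 < ‖v‖ := norm_pos_iff.2 hv0
    nlinarith [hv hm]

theorem mem_regularSubdiff_indicatorFn {S : Set E} {x d : E} :
    d ∈ regularSubdiff (indicatorFn S) x ↔
      x ∈ S ∧ ∀ ε : ℝ, 0 < ε → ∀ᶠ v in 𝓝[≠] (0 : E), x + v ∈ S → inner ℝ d v ≤ ε * ‖v‖ := by
  have h := mem_regularSubdiff_coe_add_indicatorFn (G := fun _ : E => (0 : ℝ)) (S := S)
    (x := x) (d := d)
  simpa using h

theorem regularSubdiff_subset_limitingSubdiff (F : E → EReal) (x : E) :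
    regularSubdiff F x ⊆ limitingSubdiff F x := fun d hd =>
  ⟨hd.1, hd.2.1, fun _ => x, fun _ => d, fun _ => hd, tendsto_const_nhds, tendsto_const_nhds,
    tendsto_const_nhds⟩

theorem smul_mem_regularSubdiff_indicatorFn {S : Set E} {x d : E} {t : ℝ} (ht : 0 < t)
    (hd : d ∈ regularSubdiff (indicatorFn S) x) : t • d ∈ regularSubdiff (indicatorFn S) x := by
  rw [mem_regularSubdiff_indicatorFn] at hd ⊢
  refine ⟨hd.1, fun ε hε => ?_⟩
  filter_upwards [hd.2 (ε / t) (by positivity)] with v hv hm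
  have := mul_le_mul_of_nonneg_left (hv hm) ht.le
  rw [real_inner_smul_left]
  calc t * inner ℝ d v ≤ t * (ε / t * ‖v‖) := this
    _ = ε * ‖v‖ := by field_simp

theorem eventually_mul_norm_le (K : ℝ) {ε : ℝ} (hε : 0 < ε) :
    ∀ᶠ v in 𝓝[≠] (0 : E), K * ‖v‖ ^ 2 ≤ ε * ‖v‖ := by
  have h : Tendsto (fun v : E => K * ‖v‖) (𝓝[≠] 0) (𝓝 0) := by
    have : Continuous fun v : E => K * ‖v‖ := by fun_prop
    simpa using (this.tendsto 0).mono_left nhdsWithin_le_nhds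
  filter_upwards [h.eventually_lt_const hε] with v hv
  nlinarith [norm_nonneg v]

/-- A proximal normal is a regular normal. -/
theorem mem_regularSubdiff_indicatorFn_of_inner_le {S : Set E} {x d : E} (K : ℝ) (hx : x ∈ S)
    (h : ∀ z ∈ S, inner ℝ d (z - x) ≤ K * ‖z - x‖ ^ 2) :
    d ∈ regularSubdiff (indicatorFn S) x := by
  refine mem_regularSubdiff_indicatorFn.2 ⟨hx, fun ε hε => ?_⟩
  filter_upwards [eventually_mul_norm_le K hε] with v hv hm
  have := h _ hm
  rw [add_sub_cancel_left] at this
  exact this.trans hv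

theorem mem_of_mem_regularSubdiff_indicatorFn {S : Set E} {x d : E}
    (hd : d ∈ regularSubdiff (indicatorFn S) x) : x ∈ S :=
  (mem_regularSubdiff_indicatorFn.1 hd).1

theorem mem_limitingSubdiff_indicatorFn_of_tendsto {S : Set E} {x d : E} {xs ds : ℕ → E}
    (hx : x ∈ S) (h : ∀ k, ds k ∈ regularSubdiff (indicatorFn S) (xs k))
    (hxs : Tendsto xs atTop (𝓝 x)) (hds : Tendsto ds atTop (𝓝 d)) :
    d ∈ limitingSubdiff (indicatorFn S) x := by
  have h0 : ∀ y ∈ S, indicatorFn S y = 0 := fun y hy => by simp [indicatorFn, hy]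
  refine ⟨by simp [h0 x hx], by simp [h0 x hx], xs, ds, h, hxs, ?_, hds⟩
  simp only [h0 x hx, fun k => h0 _ (mem_of_mem_regularSubdiff_indicatorFn (h k))]
  exact tendsto_const_nhds

/-! ### Projections onto convex sets -/

/-- Expand `‖z - y‖² ≥ ‖x - y‖²` around `x`; no convexity of `S` is needed. -/
theorem inner_sub_le_half_norm_sq_of_mem_projSet {S : Set E} {x y z : E} (hx : x ∈ projSet S y)
    (hz : z ∈ S) : inner ℝ (y - x) (z - x) ≤ 1 / 2 * ‖z - x‖ ^ 2 := by
  have h : ‖x - y‖ ≤ ‖z - y‖ := by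
    rw [hx.2, ← dist_eq_norm, dist_comm]
    exact Metric.infDist_le_dist_of_mem hz
  have h2 : ‖z - y‖ ^ 2 = ‖z - x‖ ^ 2 - 2 * inner ℝ (y - x) (z - x) + ‖x - y‖ ^ 2 := by
    rw [show z - y = (z - x) - (y - x) by abel, norm_sub_sq_real, real_inner_comm,
      norm_sub_rev x y]
  nlinarith [norm_nonneg (x - y)]

/-- `P` is the metric projection onto the closure of `K`, characterised by the obtuse angle
criterion. -/
structure IsConvexProj (K : Set E) (P : E → E) : Prop where
  mem_closure : ∀ x, P x ∈ closure K
  inner_le : ∀ x, ∀ w ∈ closure K, inner ℝ (x - P x) (w - P x) ≤ 0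
  infDist_eq : ∀ x, Metric.infDist x K = ‖x - P x‖

theorem exists_isConvexProj [FiniteDimensional ℝ E] {K : Set E} (hK : Convex ℝ K)
    (hne : K.Nonempty) : ∃ P, IsConvexProj K P := by
  have h : ∀ x : E, ∃ p ∈ closure K, Metric.infDist x K = ‖x - p‖ := by
    intro x
    obtain ⟨p, hp, h⟩ := isClosed_closure.exists_infDist_eq_dist hne.closure x
    exact ⟨p, hp, by rw [← Metric.infDist_closure, h, dist_eq_norm]⟩
  choose P hP hd using h
  refine ⟨P, hP, fun x => ?_, hd⟩
  refine (norm_eq_iInf_iff_real_inner_le_zero hK.closure (hP x)).1 ?_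
  rw [← hd x, ← Metric.infDist_closure, Metric.infDist_eq_iInf]
  simp only [dist_eq_norm]

namespace IsConvexProj

variable {K : Set E} {P : E → E}

theorem eq_of_inner_le (hP : IsConvexProj K P) {x p : E} (hp : p ∈ closure K)
    (h : ‖p - x‖ = Metric.infDist x K) : p = P x := by
  have h1 := hP.inner_le x p hp
  have h2 : ‖p - x‖ ^ 2 = ‖p - P x‖ ^ 2 - 2 * inner ℝ (x - P x) (p - P x) + ‖x - P x‖ ^ 2 := by
    rw [show p - x = (p - P x) - (x - P x) by abel, norm_sub_sq_real, real_inner_comm]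
  rw [h, hP.infDist_eq] at h2
  have h3 : ‖p - P x‖ ^ 2 ≤ 0 := by linarith
  exact sub_eq_zero.1 (norm_eq_zero.1 (by nlinarith [norm_nonneg (p - P x)]))

theorem eq_of_mem_closure (hP : IsConvexProj K P) {x : E} (hx : x ∈ closure K) : P x = x := by
  refine (hP.eq_of_inner_le hx ?_).symm
  rw [sub_self, norm_zero, Metric.infDist_zero_of_mem_closure hx]

theorem norm_sub_sub_le (hP : IsConvexProj K P) (x y : E) :
    ‖(x - P x) - (y - P y)‖ ≤ ‖x - y‖ := by
  have h1 := hP.inner_le x _ (hP.mem_closure y)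
  have h2 := hP.inner_le y _ (hP.mem_closure x)
  have h3 : ‖x - y‖ ^ 2 = ‖(x - P x) - (y - P y)‖ ^ 2 + ‖P x - P y‖ ^ 2
      - 2 * (inner ℝ (x - P x) (P y - P x) + inner ℝ (y - P y) (P x - P y)) := by
    rw [show x - y = ((x - P x) - (y - P y)) + (P x - P y) by abel, norm_add_sq_real,
      show P y - P x = -(P x - P y) by abel, inner_neg_right, inner_sub_left]
    ring
  refine (sq_le_sq₀ (norm_nonneg _) (norm_nonneg _)).1 ?_
  nlinarith [sq_nonneg ‖P x - P y‖]

theorem continuous_sub (hP : IsConvexProj K P) : Continuous fun x => x - P x :=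
  (LipschitzWith.of_dist_le_mul (K := 1) fun x y => by
    simpa [dist_eq_norm] using hP.norm_sub_sub_le x y).continuous

theorem continuous (hP : IsConvexProj K P) : Continuous P := by
  have h : P = fun x => x - (x - P x) := by simp
  exact h ▸ continuous_id.sub hP.continuous_sub

/-- `P x` is a competitor for the distance from `y`. With `le_half_infDist_sq`, this identifies `x -
P x` as the gradient. -/
theorem half_infDist_sq_le (hP : IsConvexProj K P) (x y : E) :
    1 / 2 * Metric.infDist y K ^ 2 ≤
      1 / 2 * Metric.infDist x K ^ 2 + inner ℝ (x - P x) (y - x) + 1 / 2 * ‖y - x‖ ^ 2 := by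
  have h : Metric.infDist y K ≤ ‖y - P x‖ := by
    rw [← Metric.infDist_closure, ← dist_eq_norm]
    exact Metric.infDist_le_dist_of_mem (hP.mem_closure x)
  have h2 : ‖y - P x‖ ^ 2 = ‖x - P x‖ ^ 2 + 2 * inner ℝ (x - P x) (y - x) + ‖y - x‖ ^ 2 := by
    rw [show y - P x = (x - P x) + (y - x) by abel, norm_add_sq_real]
  rw [hP.infDist_eq x]
  nlinarith [Metric.infDist_nonneg (x := y) (s := K)]

theorem le_half_infDist_sq (hP : IsConvexProj K P) (x y : E) :
    1 / 2 * Metric.infDist x K ^ 2 + inner ℝ (x - P x) (y - x) ≤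
      1 / 2 * Metric.infDist y K ^ 2 := by
  have h1 := hP.inner_le x _ (hP.mem_closure y)
  have h2 : ‖y - P y‖ ^ 2 = ‖x - P x‖ ^ 2 + ‖(y - P y) - (x - P x)‖ ^ 2
      + 2 * (inner ℝ (x - P x) (y - x) - inner ℝ (x - P x) (P y - P x)) := by
    rw [← inner_sub_right, show y - x - (P y - P x) = (y - P y) - (x - P x) by abel]
    conv_lhs => rw [show y - P y = (x - P x) + ((y - P y) - (x - P x)) by abel, norm_add_sq_real]
    ring
  rw [hP.infDist_eq x, hP.infDist_eq y]
  nlinarith [sq_nonneg ‖(y - P y) - (x - P x)‖]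

end IsConvexProj

/-! ### The function `½ dist(·, K)² + δ_S` -/

section FeasFn

variable {K S : Set E} {P : E → E}

theorem feasFn_of_mem (K : Set E) {x : E} (hx : x ∈ S) :
    feasFn K S x = ((1 / 2 * Metric.infDist x K ^ 2 : ℝ) : EReal) :=
  coe_add_indicatorFn_of_mem (fun x => 1 / 2 * Metric.infDist x K ^ 2) hx

theorem feasFn_of_notMem (K : Set E) {x : E} (hx : x ∉ S) : feasFn K S x = ⊤ :=
  coe_add_indicatorFn_of_notMem (fun x => 1 / 2 * Metric.infDist x K ^ 2) hx

/-- Sum rule for a smooth term: the quadratic upper bound gives one direction, the convexity lower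
bound the other. -/
theorem mem_regularSubdiff_feasFn (hP : IsConvexProj K P) {x d : E} :
    d ∈ regularSubdiff (feasFn K S) x ↔
      d - (x - P x) ∈ regularSubdiff (indicatorFn S) x := by
  rw [mem_regularSubdiff_indicatorFn]
  refine (mem_regularSubdiff_coe_add_indicatorFn
    (G := fun x => 1 / 2 * Metric.infDist x K ^ 2)).trans (and_congr_right fun _ => ?_)
  constructor
  · intro h ε hε
    filter_upwards [h (ε / 2) (by positivity),
      eventually_mul_norm_le (E := E) (1 / 2) (half_pos hε)] with v hv hv2 hm
    have h1 := hv hm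
    have h2 := hP.half_infDist_sq_le x (x + v)
    rw [add_sub_cancel_left] at h2
    rw [inner_sub_left]
    linarith
  · intro h ε hε
    filter_upwards [h ε hε] with v hv hm
    have h1 := hv hm
    have h2 := hP.le_half_infDist_sq x (x + v)
    rw [add_sub_cancel_left] at h2
    rw [inner_sub_left] at h1
    linarith

theorem mem_of_mem_limitingSubdiff_feasFn {x d : E} (hd : d ∈ limitingSubdiff (feasFn K S) x) :
    x ∈ S := by
  by_contra h
  exact hd.1 (feasFn_of_notMem K h)

theorem isCriticalPoint_feasFn_of_mem {x : E} (hK : x ∈ K) (hS : x ∈ S) :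
    IsCriticalPoint (feasFn K S) x := by
  refine regularSubdiff_subset_limitingSubdiff _ _ ((mem_regularSubdiff_coe_add_indicatorFn
    (G := fun x => 1 / 2 * Metric.infDist x K ^ 2)).2 ⟨hS, fun ε hε => .of_forall fun v _ => ?_⟩)
  rw [Metric.infDist_zero_of_mem hK, inner_zero_left]
  have : 0 ≤ ε * ‖v‖ := by positivity
  nlinarith [sq_nonneg (Metric.infDist (x + v) K)]

/-! ### Linear convergence under the KL property -/

theorem half_infDist_sq_descent (hP : IsConvexProj K P) {x x' : E} {α ε : ℝ} (hε : 0 < ε)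
    (hα : ε < α) (hα' : α < 1 - ε) (hx : x ∈ S)
    (hx' : x' ∈ projSet S ((1 - α) • x + α • P x)) :
    1 / 2 * Metric.infDist x' K ^ 2 + ε / 2 * ‖x' - x‖ ^ 2 ≤ 1 / 2 * Metric.infDist x K ^ 2 := by
  have h1 := inner_sub_le_half_norm_sq_of_mem_projSet hx' hx
  have h2 := hP.half_infDist_sq_le x x'
  have e : (1 - α) • x + α • P x - x' = -(x' - x) - α • (x - P x) := by module
  rw [e, show x - x' = -(x' - x) by abel, inner_sub_left, inner_neg_neg,
    real_inner_self_eq_norm_sq, real_inner_smul_left, inner_neg_right, norm_neg] at h1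
  have h3 : 1 / 2 * ‖x' - x‖ ^ 2 + α * inner ℝ (x - P x) (x' - x) ≤ 0 := by linarith
  have h4 : inner ℝ (x - P x) (x' - x) ≤ -(1 + ε) / 2 * ‖x' - x‖ ^ 2 := by
    have hpos : 0 < α := hε.trans hα
    refine le_of_mul_le_mul_left ?_ hpos
    -- Because `α < 1 - ε` and `(1 - ε)(1 + ε) ≤ 1`.
    have : α * (1 + ε) ≤ 1 := by nlinarith
    nlinarith [sq_nonneg ‖x' - x‖]
  linarith

/-- The projection residual divided by `α` is a normal at `x'`. Adding the gradient at `x'` leaves a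
scaled step plus a difference of gradients. -/
theorem exists_mem_limitingSubdiff_feasFn_norm_le (hP : IsConvexProj K P) {x x' : E} {α ε : ℝ}
    (hε : 0 < ε) (hα : ε < α) (hx' : x' ∈ projSet S ((1 - α) • x + α • P x)) :
    ∃ d ∈ limitingSubdiff (feasFn K S) x', ‖d‖ ≤ (ε⁻¹ + 1) * ‖x' - x‖ := by
  have hpos : 0 < α := hε.trans hα
  have hn : α⁻¹ • ((1 - α) • x + α • P x - x') ∈ regularSubdiff (indicatorFn S) x' :=
    smul_mem_regularSubdiff_indicatorFn (inv_pos.2 hpos)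
      (mem_regularSubdiff_indicatorFn_of_inner_le (1 / 2) hx'.1 fun z hz =>
        inner_sub_le_half_norm_sq_of_mem_projSet hx' hz)
  refine ⟨α⁻¹ • ((1 - α) • x + α • P x - x') + (x' - P x'),
    regularSubdiff_subset_limitingSubdiff _ _ ((mem_regularSubdiff_feasFn hP).2 ?_), ?_⟩
  · simpa using hn
  · have e : α⁻¹ • ((1 - α) • x + α • P x - x') + (x' - P x') =
        -(α⁻¹ • (x' - x)) + ((x' - P x') - (x - P x)) := by
      have : (1 - α) • x + α • P x - x' = -(x' - x) - α • (x - P x) := by module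
      rw [this, smul_sub, smul_neg, inv_smul_smul₀ hpos.ne']
      abel
    rw [e]
    refine (norm_add_le _ _).trans ?_
    rw [norm_neg, norm_smul, Real.norm_of_nonneg (inv_pos.2 hpos).le, add_mul, one_mul]
    gcongr
    exact hP.norm_sub_sub_le x' x

theorem convergesLinearly_of_eventually {x : ℕ → E} {xbar : E} (m : ℕ)
    (h : ConvergesLinearly (fun k => x (k + m)) xbar) : ConvergesLinearly x xbar := by
  obtain ⟨M, q, hM, hq, hq1, h⟩ := h
  have hs : 0 ≤ ∑ j ∈ Finset.range m, ‖x j - xbar‖ :=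
    Finset.sum_nonneg fun _ _ => norm_nonneg _
  refine ⟨(M + ∑ j ∈ Finset.range m, ‖x j - xbar‖) / q ^ m, q, by positivity, hq, hq1,
    fun k => ?_⟩
  rw [div_mul_eq_mul_div, le_div_iff₀ (by positivity)]
  rcases lt_or_ge k m with hk | hk
  · have h1 : ‖x k - xbar‖ ≤ ∑ j ∈ Finset.range m, ‖x j - xbar‖ :=
      Finset.single_le_sum (f := fun j => ‖x j - xbar‖) (fun _ _ => norm_nonneg _)
        (Finset.mem_range.2 hk)
    have h2 : q ^ m ≤ q ^ k := pow_le_pow_of_le_one hq.le hq1.le hk.le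
    calc _ ≤ (M + ∑ j ∈ Finset.range m, ‖x j - xbar‖) * q ^ m := by gcongr; linarith
      _ ≤ _ := by gcongr
  · obtain ⟨n, rfl⟩ := Nat.exists_eq_add_of_le' hk
    calc _ ≤ M * q ^ n * q ^ m := by gcongr; exact h n
      _ = M * q ^ (n + m) := by ring
      _ ≤ _ := by gcongr; linarith

/-- Sufficient decrease together with an error bound of square root type gives linear
convergence. -/
theorem convergesLinearly_of_sufficient_decrease {x : ℕ → E} {xbar : E} {h : ℕ → ℝ} {a b : ℝ}
    (ha : 0 < a) (hb : 0 < b) (hnn : ∀ k, 0 ≤ h k)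
    (hdec : ∀ k, h (k + 1) + a * ‖x (k + 1) - x k‖ ^ 2 ≤ h k)
    (herr : ∀ k, h (k + 1) ≤ b * ‖x (k + 1) - x k‖ ^ 2)
    (hx : Tendsto x atTop (𝓝 xbar)) : ConvergesLinearly x xbar := by
  set ρ : ℝ := b / (a + b) with hρ
  have hρ0 : 0 < ρ := by positivity
  have hρ1 : ρ < 1 := by rw [hρ, div_lt_one (by positivity)]; linarith
  -- Add `b` times the decrease to `a` times the error bound.
  have hstep : ∀ k, h (k + 1) ≤ ρ * h k := by
    intro k
    rw [hρ, div_mul_eq_mul_div, le_div_iff₀ (by positivity)]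
    nlinarith [hdec k, herr k]
  have hgeo : ∀ k, h k ≤ h 0 * ρ ^ k := by
    intro k
    induction k with
    | zero => simp
    | succ k ih =>
      calc h (k + 1) ≤ ρ * h k := hstep k
        _ ≤ ρ * (h 0 * ρ ^ k) := by gcongr
        _ = h 0 * ρ ^ (k + 1) := by ring
  have hq0 : 0 < √ρ := Real.sqrt_pos.2 hρ0
  have hq1 : √ρ < 1 := (Real.sqrt_lt' one_pos).2 (by simpa using hρ1)
  have hdist : ∀ k, dist (x k) (x (k + 1)) ≤ √(h 0 / a) * √ρ ^ k := by
    intro k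
    rw [dist_comm, dist_eq_norm]
    refine (sq_le_sq₀ (norm_nonneg _) (by positivity)).1 ?_
    rw [mul_pow, Real.sq_sqrt (div_nonneg (hnn 0) ha.le), ← pow_mul, mul_comm k 2, pow_mul,
      Real.sq_sqrt hρ0.le, div_mul_eq_mul_div, le_div_iff₀ ha]
    linarith [hdec k, hgeo k, hnn (k + 1)]
  -- Geometric tail of the steps; the `+ 1` keeps `M` positive if `h 0 = 0`.
  refine ⟨√(h 0 / a) / (1 - √ρ) + 1, √ρ, ?_, hq0, hq1, fun k => ?_⟩
  · have : 0 < 1 - √ρ := by linarith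
    positivity
  · have := dist_le_of_le_geometric_of_tendsto _ _ hq1 hdist hx k
    rw [dist_eq_norm] at this
    refine this.trans ?_
    rw [add_mul, div_mul_eq_mul_div]
    have : 0 < √ρ ^ k := by positivity
    linarith

theorem convergesLinearly_of_hasKLProperty [FiniteDimensional ℝ E] (hK : Convex ℝ K) {xbar : E}
    {α : ℕ → ℝ} {x : ℕ → E} (hα : AdmissibleSteps α) (hx : IsRelaxedAltProj K S α x)
    (hlim : Tendsto x atTop (𝓝 xbar)) (hKL : HasKLProperty (feasFn K S) xbar (1 / 2)) :
    ConvergesLinearly x xbar := by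
  obtain ⟨ε, hε, -, hα⟩ := hα
  obtain ⟨⟨d₀, hd₀⟩, c, δ, ν, hc, hδ, hν, hKL⟩ := hKL
  have hxbar : xbar ∈ S := mem_of_mem_limitingSubdiff_feasFn hd₀
  have hne : K.Nonempty := by
    obtain ⟨p, hp, -⟩ := hx 0
    exact ⟨p, hp.1⟩
  obtain ⟨P, hP⟩ := exists_isConvexProj hK hne
  have hproj : ∀ k, x (k + 1) ∈ projSet S ((1 - α k) • x k + α k • P (x k)) := by
    intro k
    obtain ⟨p, hp, h⟩ := hx k
    rwa [hP.eq_of_inner_le (subset_closure hp.1) hp.2] at h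
  set g : E → ℝ := fun y => 1 / 2 * Metric.infDist y K ^ 2 with hg
  have hgc : Continuous g := by
    have := Metric.continuous_infDist_pt K
    fun_prop
  have hglim : Tendsto (fun k => g (x k)) atTop (𝓝 (g xbar)) := (hgc.tendsto xbar).comp hlim
  have hmem : ∀ k, x (k + 1) ∈ S := fun k => (hproj k).1
  -- Starts at index 1, as `x 0` need not lie in `S`.
  have hdesc : ∀ k, g (x (k + 2)) + ε / 2 * ‖x (k + 2) - x (k + 1)‖ ^ 2 ≤ g (x (k + 1)) :=
    fun k => half_infDist_sq_descent hP hε (hα _).1 (hα _).2 (hmem k) (hproj (k + 1))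
  have hanti : Antitone fun k => g (x (k + 1)) := by
    refine antitone_nat_of_succ_le fun k => ?_
    have : 0 ≤ ε / 2 * ‖x (k + 2) - x (k + 1)‖ ^ 2 := by positivity
    linarith [hdesc k]
  have hge : ∀ k, g xbar ≤ g (x (k + 1)) := fun k =>
    hanti.le_of_tendsto (hglim.comp (tendsto_add_atTop_nat 1)) k
  have hν' : ∀ᶠ k in atTop, ((g (x k) : ℝ) : EReal) < ((g xbar : ℝ) : EReal) + ν := by
    refine ((continuous_coe_real_ereal.tendsto (g xbar)).comp hglim).eventually_lt_const ?_
    simpa using EReal.add_lt_add_left_coe hν (g xbar)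
  have hclose : ∀ᶠ k in atTop, ‖x k - xbar‖ ≤ δ := by
    filter_upwards [hlim.eventually (Metric.closedBall_mem_nhds xbar hδ)] with k hk
    rwa [← dist_eq_norm]
  obtain ⟨m, hm⟩ := eventually_atTop.1 (hν'.and hclose)
  refine convergesLinearly_of_eventually (m + 1) ?_
  refine convergesLinearly_of_sufficient_decrease (h := fun k => g (x (k + (m + 1))) - g xbar)
    (a := ε / 2) (b := ((ε⁻¹ + 1) / c) ^ 2) (by positivity) (by positivity)
    (fun k => sub_nonneg.2 (hge (k + m))) (fun k => ?_) (fun k => ?_)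
    (hlim.comp (tendsto_add_atTop_nat (m + 1)))
  · have h := hdesc (k + m)
    have e : k + 1 + (m + 1) = k + m + 2 := by ring
    simp only [e, ← add_assoc]
    linarith
  · have e : k + 1 + (m + 1) = k + m + 1 + 1 := by ring
    simp only [e, ← add_assoc]
    -- KL only speaks above the limit value; at that value the gap is zero.
    rcases (hge (k + m + 1)).eq_or_lt with h0 | h0
    · rw [← h0, sub_self]; positivity
    obtain ⟨d, hd, hdn⟩ := exists_mem_limitingSubdiff_feasFn_norm_le hP hε
      (hα (k + m + 1)).1 (hproj (k + m + 1))
    obtain ⟨h1, h2⟩ := hm (k + m + 1 + 1) (by omega)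
    have hF := feasFn_of_mem K (hmem (k + m + 1))
    have hFb := feasFn_of_mem K hxbar
    have h3 := hKL (x (k + m + 1 + 1)) h2 (by rw [hF, hFb]; exact_mod_cast h0)
      (by rw [hF, hFb]; exact h1)
    have h4 := h3.trans (Metric.infEDist_le_edist_of_mem hd)
    rw [hF, hFb, ← EReal.coe_sub, EReal.toReal_coe, ← Real.sqrt_eq_rpow, edist_dist, dist_zero_left,
      ENNReal.ofReal_le_ofReal_iff (norm_nonneg _)] at h4
    have h5 : √(g (x (k + m + 1 + 1)) - g xbar) ≤
        (ε⁻¹ + 1) / c * ‖x (k + m + 1 + 1) - x (k + m + 1)‖ := by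
      rw [div_mul_eq_mul_div, le_div_iff₀ hc, mul_comm]
      exact h4.trans hdn
    have h6 := Real.sqrt_le_left (by positivity) |>.1 h5
    rwa [mul_pow] at h6

/-! ### Transversality implies the KL property -/

/-- Otherwise normalised gradients at points tending to `xbar` subconverge to a unit `w`, normal to
`K` by the obtuse angle criterion, while the rescaled `n` tend to `-w`, normal to `S`. -/
theorem exists_mul_norm_le_of_transversal_regular [FiniteDimensional ℝ E]
    (hP : IsConvexProj K P) {xbar : E} (hxK : xbar ∈ K) (hxS : xbar ∈ S)
    (htr : Transversal K S xbar) :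
    ∃ c > 0, ∀ x, ‖x - xbar‖ < c → ∀ n ∈ regularSubdiff (indicatorFn S) x,
      c * ‖x - P x‖ ≤ ‖x - P x + n‖ := by
  by_contra! hcon
  have hpos : ∀ k : ℕ, (0 : ℝ) < 1 / ((k : ℝ) + 1) := fun k => Nat.one_div_pos_of_nat
  choose x hx n hn hlt using fun k : ℕ => hcon (1 / ((k : ℝ) + 1)) (hpos k)
  have h0 : Tendsto (fun k : ℕ => 1 / ((k : ℝ) + 1)) atTop (𝓝 0) :=
    tendsto_one_div_add_atTop_nhds_zero_nat
  have hxlim : Tendsto x atTop (𝓝 xbar) :=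
    tendsto_iff_norm_sub_tendsto_zero.2
      (squeeze_zero (fun _ => norm_nonneg _) (fun k => (hx k).le) h0)
  set t : ℕ → ℝ := fun k => ‖x k - P (x k)‖
  have ht : ∀ k, 0 < t k := fun k =>
    pos_of_mul_pos_right ((norm_nonneg _).trans_lt (hlt k)) (hpos k).le
  set u : ℕ → E := fun k => (t k)⁻¹ • (x k - P (x k))
  have hu1 : ∀ k, u k ∈ Metric.sphere (0 : E) 1 := fun k => by
    simp only [u, mem_sphere_zero_iff_norm, norm_smul, norm_inv, Real.norm_of_nonneg (ht k).le]
    exact inv_mul_cancel₀ (ht k).ne'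
  obtain ⟨w, hw, φ, hφ, hφlim⟩ := (isCompact_sphere (0 : E) 1).tendsto_subseq hu1
  have hsum : Tendsto (fun k => u k + (t k)⁻¹ • n k) atTop (𝓝 0) := by
    refine squeeze_zero_norm (fun k => ?_) h0
    rw [← smul_add, norm_smul, norm_inv, Real.norm_of_nonneg (ht k).le, inv_mul_le_iff₀ (ht k),
      mul_comm]
    exact (hlt k).le
  have hnlim : Tendsto (fun k => (t (φ k))⁻¹ • n (φ k)) atTop (𝓝 (-w)) := by
    simpa using (hsum.comp hφ.tendsto_atTop).sub hφlim
  have hS : -w ∈ normalCone S xbar :=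
    mem_limitingSubdiff_indicatorFn_of_tendsto hxS
      (fun k => smul_mem_regularSubdiff_indicatorFn (inv_pos.2 (ht (φ k))) (hn (φ k)))
      (hxlim.comp hφ.tendsto_atTop) hnlim
  have hPlim : Tendsto (fun k => P (x (φ k))) atTop (𝓝 xbar) := by
    have := (hP.continuous.tendsto xbar).comp (hxlim.comp hφ.tendsto_atTop)
    rwa [hP.eq_of_mem_closure (subset_closure hxK)] at this
  have hKn : w ∈ normalCone K xbar := by
    refine regularSubdiff_subset_limitingSubdiff _ _
      (mem_regularSubdiff_indicatorFn_of_inner_le 0 hxK fun z hz => ?_)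
    rw [zero_mul]
    refine le_of_tendsto (hφlim.inner (tendsto_const_nhds.sub hPlim)) (.of_forall fun k => ?_)
    simp only [Function.comp_apply, u, real_inner_smul_left]
    exact mul_nonpos_of_nonneg_of_nonpos (inv_pos.2 (ht _)).le
      (hP.inner_le _ z (subset_closure hz))
  have hw0 : w = 0 := by
    have : w ∈ {d | d ∈ normalCone K xbar ∧ -d ∈ normalCone S xbar} := ⟨hKn, hS⟩
    rwa [htr] at this
  simp [hw0] at hw

theorem hasKLProperty_feasFn_of_transversal [FiniteDimensional ℝ E] (hK : Convex ℝ K) {xbar : E}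
    (hxK : xbar ∈ K) (hxS : xbar ∈ S) (htr : Transversal K S xbar) :
    HasKLProperty (feasFn K S) xbar (1 / 2) := by
  obtain ⟨P, hP⟩ := exists_isConvexProj hK ⟨xbar, hxK⟩
  obtain ⟨c, hc, h⟩ := exists_mul_norm_le_of_transversal_regular hP hxK hxS htr
  -- Radius `c / 2` lets sequences approximating `x` eventually enter the open `c`-ball.
  refine ⟨⟨0, isCriticalPoint_feasFn_of_mem hxK hxS⟩, c, c / 2, ⊤, hc, half_pos hc,
    EReal.zero_lt_top, fun x hx _ hlt => Metric.le_infEDist.2 fun d hd => ?_⟩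
  have hxmem := mem_of_mem_limitingSubdiff_feasFn hd
  obtain ⟨-, -, xs, ds, hreg, hxs, -, hds⟩ := hd
  have hle : c * ‖x - P x‖ ≤ ‖d‖ := by
    refine le_of_tendsto_of_tendsto
      (((hP.continuous_sub.tendsto x).comp hxs).norm.const_mul c) hds.norm ?_
    have hev : ∀ᶠ k in atTop, ‖xs k - xbar‖ < c :=
      (hxs.sub_const xbar).norm.eventually_lt_const (by linarith)
    filter_upwards [hev] with k hk
    simpa using h (xs k) hk _ ((mem_regularSubdiff_feasFn hP).1 (hreg k))
  rw [feasFn_of_mem K hxmem, feasFn_of_mem K hxS, Metric.infDist_zero_of_mem hxK, hP.infDist_eq,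
    ← EReal.coe_sub, EReal.toReal_coe, ← Real.sqrt_eq_rpow, edist_dist, dist_zero_left]
  refine ENNReal.ofReal_le_ofReal (le_trans ?_ hle)
  gcongr
  refine Real.sqrt_le_iff.2 ⟨norm_nonneg _, ?_⟩
  nlinarith [sq_nonneg ‖x - P x‖]

end FeasFn

end EigProg

theorem mainTheorem4 {E : Type*} [NormedAddCommGroup E] [InnerProductSpace ℝ E]
    [FiniteDimensional ℝ E] {r : ℕ} (lam : E → EuclideanSpace ℝ (Fin r))
    (hlam : EigProg.IsFTvN lam) (C : Set (EuclideanSpace ℝ (Fin r)))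
    (Cbar : Set E) (hCbar : Convex ℝ Cbar) (xbar : E) :
    (∀ (α : ℕ → ℝ) (x : ℕ → E), EigProg.AdmissibleSteps α →
        EigProg.IsRelaxedAltProj Cbar (lam ⁻¹' C) α x →
        Filter.Tendsto x Filter.atTop (nhds xbar) →
        EigProg.IsCriticalPoint (EigProg.feasFn Cbar (lam ⁻¹' C)) xbar →
        EigProg.HasKLProperty (EigProg.feasFn Cbar (lam ⁻¹' C)) xbar (1 / 2) →
        EigProg.ConvergesLinearly x xbar) ∧
    (xbar ∈ Cbar ∩ lam ⁻¹' C → EigProg.Transversal Cbar (lam ⁻¹' C) xbar →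
        EigProg.IsCriticalPoint (EigProg.feasFn Cbar (lam ⁻¹' C)) xbar ∧
        EigProg.HasKLProperty (EigProg.feasFn Cbar (lam ⁻¹' C)) xbar (1 / 2) ∧
        ∀ (α : ℕ → ℝ) (x : ℕ → E), EigProg.AdmissibleSteps α →
          EigProg.IsRelaxedAltProj Cbar (lam ⁻¹' C) α x →
          Filter.Tendsto x Filter.atTop (nhds xbar) →
          EigProg.ConvergesLinearly x xbar) := by
  refine ⟨fun α x hα hx hlim _ hKL => ?_, fun hx htr => ?_⟩
  · exact EigProg.convergesLinearly_of_hasKLProperty hCbar hα hx hlim hKL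
  · have hKL := EigProg.hasKLProperty_feasFn_of_transversal hCbar hx.1 hx.2 htr
    exact ⟨EigProg.isCriticalPoint_feasFn_of_mem hx.1 hx.2, hKL, fun α x hα hx hlim =>
      EigProg.convergesLinearly_of_hasKLProperty hCbar hα hx hlim hKL⟩
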